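/- **Setting.** Let $\varphi=(Q,q_0,\Sigma_I\times\Sigma_O,\delta,F)$ be a deterministic safety automaton with finite state set and finite non-empty alphabets; a reactive system (finite Mealy machine) satisfies $\varphi$ if all its runs visit only states of $F$. Let $W$ be the winning region of $\varphi$ as a safety game (the environment picks $\sigma_I$, then the system picks $\sigma_O$), and assume $q_0\in W$, i.e. $\varphi$ is realizable. **Monitors.** The violation monitor has states $(u,d)\in 2^Q\times\{0,1,2\}$ and initial state $(\{q_0\},0)$. It reads $(\sigma_I,\sigma_O)$ (input and design output) and a bit $z$. If $\delta(q,(\sigma_I,\sigma_O))\notin W$ for all $q\in u$ (a violation), it goes to $(\{q'\in W\mid \exists q\in u,\ \sigma_O':\delta(q,(\sigma_I,\sigma_O'))=q'\},2)$. Otherwise it goes to $(\{q'\in W\mid\exists q\in u:\delta(q,(\sigma_I,\sigma_O))=q'\},\mathrm{dec}(d))$, where $\mathrm{dec}(0)=\mathrm{dec}(1)=0$, and $\mathrm{dec}(2)=1$ if $z$ is true and $2$ otherwise. The deviation monitor is in $t_1$ if the last output $\sigma_O'$ of the shield differed from the output $\sigma_O$ of the design, and in $t_0$ otherwise (also initially).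 The recovery phase is *over* when $d\le 1$. **Games.** In the safety game $\mathcal G^s$ the environment picks $(\sigma_I,\sigma_O)$ and the shield answers with $(\sigma_O',z)$. Its graph is the synchronous product of the violation monitor, the deviation monitor and $\varphi$ (which reads $(\sigma_I,\sigma_O')$). The safe states are those $((u,d),t,q)$ with $q\in F$ and ($d=0\Rightarrow t=t_0$). The Büchi game $\mathcal G^b$ is the restriction of $\mathcal G^s$ to its winning region $W^s$ (transitions staying in $W^s$), with accepting states those with $d\le1$. In a Büchi game, let the *attractor number* of a state be the least $n$ such that the system can force, within $n$ steps, a visit to an accepting state that is winning for it ($\infty$ if there is none). **Admissible strategy.** Let $W^b$ be the winning region of $\mathcal G^b$, and let $\rho^b_w$ be the (non-deterministic) winning strategy that, at every state $g$ and input letter $x$ from which some transition leads into $W^b$, consists of all answers leading to a successor in $W^b$ of least attractor number. Wherever $\rho^b_w$ prescribes an answer, delete all other transitions of $\mathcal G^b$; this gives $\mathcal G^b_1$. Turn all inputs of $\mathcal G^b_1$ into outputs; this gives the one-player Büchi game $\mathcal G^b_2$. An admissible strategy $\rho^b$ answers $x$ in state $g$ by a transition of $\mathcal G_1^b$ to a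 successor of least attractor number in $\mathcal G_2^b$. **Shields.** A shield is a reactive system $\mathcal S$ with inputs $(\sigma_I,\sigma_O)$ and outputs $(\sigma_O',z)$ such that $\mathcal D\circ\mathcal S\models\varphi$ for every design $\mathcal D$, and such that it does not deviate ($\sigma_O'=\sigma_O$) in any step after which $d=0$. A trace is a finite word of letters $(\sigma_I,\sigma_O)$. * $\mathcal S$ *adversely $k$-stabilizes* a trace if, for every infinite continuation of the trace, the recovery phase is over after at most $k$ further steps, and is over infinitely often. * $\mathcal S$ *collaboratively $k$-stabilizes* a trace if, for some continuation, the recovery phase is over after at most $k$ further steps. When another shield is compared with $\mathcal S$ on a trace, it has to give the same answers as $\mathcal S$ on all letters of the trace but the last. A shield $\mathcal S$ is *admissible* if 1. for every trace and every $k$: if some such shield adversely $k$-stabilizes the trace, then $\mathcal S$ does; and 2. for every trace that no such shield adversely $k$-stabilizes for any $k$: if, for some $k$, some such shield that also satisfies (1) collaboratively $k$-stabilizes the trace, then $\mathcal S$ collaboratively $k$-stabilizes it (so $\mathcal S$ attains the minimal $k$). **Theorem.** An admissible strategy $\rho^b$ of $\mathcal G^b$ exists, and for every such strategy the reactive system $\mathcal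 S=(G^b,g^b_0,\Sigma_I^b,\Sigma_O^b,\delta',\rho^b)$ with $\delta'(g,x)=\delta^b(g,x,\rho^b(g,x))$ is an admissible shield. -/

import Mathlib

noncomputable section

namespace Shielding

/-! ### Reactive systems -/

/-- A reactive system: a finite-state Mealy machine. -/
structure Mealy (A B : Type) where
  State : Type
  finite_state : Finite State
  init : State
  next : State → A → State
  out : State → A → B

namespace Mealy

variable {A B : Type}

/-- The state reached after reading a finite word. -/
def stateAfter (M : Mealy A B) (l : List A) : M.State := l.foldl M.next M.init

/-- The input/output trace produced from the state `s` on a finite input word. -/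
def traceFrom (M : Mealy A B) : M.State → List A → List (A × B)
  | _, [] => []
  | s, a :: l => (a, M.out s a) :: M.traceFrom (M.next s a) l

/-- The input/output trace produced from the initial state. -/
def trace (M : Mealy A B) (l : List A) : List (A × B) := M.traceFrom M.init l

end Mealy

/-- The composition `D ∘ S` of a design and a shield.  The shield reads the input and the output of
the design, and its own output consists of the corrected output letter and the flag `z`. -/
def comp {I O : Type} (D : Mealy I O) (S : Mealy (I × O) (O × Bool)) : Mealy I O where
  State := D.State × S.State
  finite_state := by
    have := D.finite_state
    have := S.finite_state
    infer_instance
  init := (D.init, S.init)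
  next := fun s i => (D.next s.1 i, S.next s.2 (i, D.out s.1 i))
  out := fun s i => (S.out s.2 (i, D.out s.1 i)).1

/-! ### Games

The environment chooses a letter in `X`, and then the system answers with a letter in `Y`. -/

/-- A game graph with a deterministic next-state function.  `legal g x` is the set of answers `y`
for which the transition from `g` labelled `(x, y)` is present. -/
structure Game (V X Y : Type) where
  next : V → X → Y → V
  legal : V → X → Set Y

/-- The prefix of length `n` of an infinite word. -/
def prefixOf {X : Type} (w : ℕ → X) (n : ℕ) : List X := (List.range n).map w

namespace Game

variable {V X Y : Type}

/-- The play from `g` in which the environment plays `w` and the system uses the strategy `f`, which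
sees the earlier letters of the environment and the current one. -/
def play (G : Game V X Y) (f : List X → X → Y) (g : V) (w : ℕ → X) : ℕ → V
  | 0 => g
  | n + 1 => G.next (G.play f g w n) (w n) (f (prefixOf w n) (w n))

/-- The states from which the system has a strategy that uses only transitions of the game and all
of whose plays meet the objective. -/
def winRegion (G : Game V X Y) (objective : (ℕ → V) → Prop) : Set V :=
  {g | ∃ f : List X → X → Y, ∀ w : ℕ → X,
    (∀ n, f (prefixOf w n) (w n) ∈ G.legal (G.play f g w n) (w n)) ∧ objective (G.play f g w)}

/-- Safety objective: only states in `F` are visited. -/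
def safety (F : Set V) (v : ℕ → V) : Prop := ∀ n, v n ∈ F

/-- Büchi objective: `F` is visited infinitely often. -/
def buchi (F : Set V) (v : ℕ → V) : Prop := ∀ n, ∃ m, n ≤ m ∧ v m ∈ F

/-- The `n`-th attractor of `T`: the states from which the system can force a visit of `T` within
`n` steps. -/
def attractor (G : Game V X Y) (T : Set V) : ℕ → Set V
  | 0 => T
  | n + 1 => G.attractor T n ∪
      {g | ∀ x, ∃ y ∈ G.legal g x, G.next g x y ∈ G.attractor T n}

/-- The attractor number of a state with respect to `T` (`⊤` if no visit of `T` can be forced). -/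
def attractorNumber (G : Game V X Y) (T : Set V) (g : V) : ℕ∞ :=
  ⨅ (n : ℕ) (_ : g ∈ G.attractor T n), (n : ℕ∞)

/-- The winning region of the Büchi game with accepting states `F`. -/
def buchiRegion (G : Game V X Y) (F : Set V) : Set V := G.winRegion (buchi F)

/-- The attractor number for the Büchi objective `F`: the number of steps within which the system
can force a visit to an accepting state that is itself winning. -/
def buchiNumber (G : Game V X Y) (F : Set V) (g : V) : ℕ∞ :=
  G.attractorNumber (F ∩ G.buchiRegion F) g

/-- The winning strategy of the Büchi game, as a set of triples `(g, x, y)`: at every position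
`(g, x)` from which the winning region can be reached, it goes to a winning state with the least
attractor number among all available successors. -/
def buchiStrategy (G : Game V X Y) (F : Set V) (g : V) (x : X) : Set Y :=
  {y | y ∈ G.legal g x ∧ G.next g x y ∈ G.buchiRegion F ∧
    ∀ y' ∈ G.legal g x, G.buchiNumber F (G.next g x y) ≤ G.buchiNumber F (G.next g x y')}

/-- The game with the same states in which, wherever the strategy `ρ` prescribes some answer, only
the transitions of `ρ` are kept. -/
def prune (G : Game V X Y) (ρ : V → X → Set Y) : Game V X Y where
  next := G.next
  legal := fun g x => {y | y ∈ ρ g x ∨ ((∀ y', y' ∉ ρ g x) ∧ y ∈ G.legal g x)}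

/-- The game in which the letters of the environment are chosen by the system as well. -/
def cooperative (G : Game V X Y) : Game V Unit (X × Y) where
  next := fun g _ a => G.next g a.1 a.2
  legal := fun g _ => {a | a.2 ∈ G.legal g a.1}

/-- The admissible strategies of the Büchi game with accepting states `F`: compute the winning
strategy, remove the competing transitions, turn all inputs of the resulting game into outputs, and
follow the attractor strategy of the game so obtained, i.e. answer `x` in state `g` by moving to a
successor with the least attractor number. -/
def IsAdmissibleStrategy (G : Game V X Y) (F : Set V) (ρ : V → X → Y) : Prop :=
  ∀ g x, ρ g x ∈ (G.prune (G.buchiStrategy F)).legal g x ∧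
    ∀ y ∈ (G.prune (G.buchiStrategy F)).legal g x,
      (G.prune (G.buchiStrategy F)).cooperative.buchiNumber F (G.next g x (ρ g x)) ≤
        (G.prune (G.buchiStrategy F)).cooperative.buchiNumber F (G.next g x y)

end Game

/-! ### Safety specifications, monitors and the games built from them -/

/-- A safety automaton over the alphabet `I × O`. -/
structure SafetySpec (Q I O : Type) where
  init : Q
  step : Q → I × O → Q
  safe : Set Q

namespace SafetySpec

variable {Q I O : Type} (φ : SafetySpec Q I O)

/-- `M ⊨ φ`: on every input word the run of the automaton visits safe states only. -/
def SatisfiedBy (M : Mealy I O) : Prop :=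
  ∀ l : List I, (M.trace l).foldl φ.step φ.init ∈ φ.safe

/-- The specification as a safety game: the environment chooses the input, the system the output. -/
def specGame : Game Q I O where
  next := fun q i o => φ.step q (i, o)
  legal := fun _ _ => Set.univ

/-- The winning region `W` of the specification. -/
def W : Set Q := φ.specGame.winRegion (Game.safety φ.safe)

/-- States of the violation monitor: the set of monitored states and the counter `d`. -/
abbrev MonitorState (Q : Type) : Type := Set Q × Fin 3

/-- The letter is a violation: it leaves `W` from every monitored state. -/
def Violates (u : Set Q) (x : I × O) : Prop := ∀ q ∈ u, φ.step q x ∉ φ.W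

/-- The decrement of the counter. -/
def dec (d : Fin 3) (z : Bool) : Fin 3 := if d = 2 then (if z then 1 else 2) else 0

open Classical in
/-- The next-state function of the violation monitor; `x` is the letter (input, design output) and
`z` the flag set by the shield. -/
def monitorStep (v : MonitorState Q) (x : I × O) (z : Bool) : MonitorState Q :=
  if φ.Violates v.1 x then
    ({q' | q' ∈ φ.W ∧ ∃ q ∈ v.1, ∃ o' : O, φ.step q (x.1, o') = q'}, 2)
  else
    ({q' | q' ∈ φ.W ∧ ∃ q ∈ v.1, φ.step q x = q'}, dec v.2 z)

/-- The initial state of the violation monitor. -/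
def monitorInit : MonitorState Q := ({φ.init}, 0)

open Classical in
/-- The deviation monitor: its state is `true` iff the shield has deviated in the last step. -/
def deviationStep (_ : Bool) (o o' : O) : Bool := decide (o ≠ o')

/-- States of the product of violation monitor, deviation monitor and safety automaton. -/
abbrev ProductState (Q : Type) : Type := MonitorState Q × Bool × Q

/-- The graph of the safety game on the product. -/
def safetyGame : Game (ProductState Q) (I × O) (O × Bool) where
  next := fun g x y =>
    (φ.monitorStep g.1 x y.2, deviationStep g.2.1 x.2 y.1, φ.step g.2.2 (x.1, y.1))
  legal := fun _ _ => Set.univ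

/-- The initial state of the product. -/
def productInit : ProductState Q := (φ.monitorInit, false, φ.init)

/-- The safe states of the product: the automaton is in a safe state, and outside the recovery
phase there is no deviation. -/
def productSafe : Set (ProductState Q) :=
  {g | g.2.2 ∈ φ.safe ∧ (g.1.2 = 0 → g.2.1 = false)}

/-- The winning region of the safety game. -/
def Ws : Set (ProductState Q) := φ.safetyGame.winRegion (Game.safety φ.productSafe)

open Classical in
/-- The graph of the Büchi game: the winning region of the safety game, with the transitions of the
most permissive winning strategy, i.e. those that stay in it.  The value of `next` on absent
transitions is irrelevant. -/
def buchiGame : Game φ.Ws (I × O) (O × Bool) where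
  next := fun g x y =>
    if h : φ.safetyGame.next g.1 x y ∈ φ.Ws then ⟨φ.safetyGame.next g.1 x y, h⟩ else g
  legal := fun g x => {y | φ.safetyGame.next g.1 x y ∈ φ.Ws}

/-- The accepting states of the Büchi game: `d ≤ 1`. -/
def buchiAccept : Set φ.Ws := {g | g.1.1.2 ≤ 1}

/-! ### Shields and stabilization -/

/-- The value of the counter `d` of the violation monitor after a finite trace of a shield.
The recovery phase is over when `d ≤ 1`. -/
def counter (τ : List ((I × O) × (O × Bool))) : Fin 3 :=
  (τ.foldl (fun v e => φ.monitorStep v e.1 e.2.2) φ.monitorInit).2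

/-- A shield with respect to `φ`: it corrects the outputs of every design such that `φ` holds, and
it deviates from the output of the design only in the recovery phase. -/
structure IsShield (S : Mealy (I × O) (O × Bool)) : Prop where
  correct : ∀ D : Mealy I O, φ.SatisfiedBy (comp D S)
  minimum_deviation : ∀ (l : List (I × O)) (x : I × O),
    φ.counter (S.trace (l ++ [x])) = 0 → (S.out (S.stateAfter l) x).1 = x.2

/-- The recovery phase is over once `S` has processed the word `l`. -/
def Recovered (S : Mealy (I × O) (O × Bool)) (l : List (I × O)) : Prop :=
  φ.counter (S.trace l) ≤ 1

/-- `S` adversely `k`-stabilizes the trace `p` (a finite word of inputs and design outputs): however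
the trace continues, the recovery phase ends within `k` steps, and no later recovery phase lasts
forever. -/
def AdverselyStabilizes (S : Mealy (I × O) (O × Bool)) (k : ℕ) (p : List (I × O)) : Prop :=
  ∀ w : ℕ → I × O,
    (∃ j ≤ k, φ.Recovered S (p ++ prefixOf w j)) ∧
    (∀ n, ∃ m, n ≤ m ∧ φ.Recovered S (p ++ prefixOf w m))

/-- `S` collaboratively `k`-stabilizes the trace `p`: for some continuation of the trace the recovery
phase ends within `k` steps. -/
def CollaborativelyStabilizes (S : Mealy (I × O) (O × Bool)) (k : ℕ) (p : List (I × O)) : Prop :=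
  ∃ w : ℕ → I × O, ∃ j ≤ k, φ.Recovered S (p ++ prefixOf w j)

/-- `S'` has given the same answers as `S` before the last letter of the trace `p`. -/
def SamePast (S S' : Mealy (I × O) (O × Bool)) (p : List (I × O)) : Prop :=
  S'.trace p.dropLast = S.trace p.dropLast

/-- Some shield with the same past as `S` adversely `k`-stabilizes the trace `p`. -/
def AdverselyStabilizable (S : Mealy (I × O) (O × Bool)) (k : ℕ) (p : List (I × O)) : Prop :=
  ∃ S' : Mealy (I × O) (O × Bool),
    φ.IsShield S' ∧ SamePast S S' p ∧ φ.AdverselyStabilizes S' k p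

/-- Subgame optimality: whenever adverse `k`-stabilization of a trace is possible, `S` achieves it. -/
def SubgameOptimal (S : Mealy (I × O) (O × Bool)) : Prop :=
  ∀ (p : List (I × O)) (k : ℕ), φ.AdverselyStabilizable S k p → φ.AdverselyStabilizes S k p

/-- Admissible shields.  Every trace is adversely stabilized with minimal `k` whenever this is
possible for some `k`; otherwise it is collaboratively stabilized with a `k` that is minimal among
the shields that meet the first requirement. -/
structure IsAdmissibleShield (S : Mealy (I × O) (O × Bool)) : Prop where
  shield : φ.IsShield S
  adverse : φ.SubgameOptimal S
  collaborative : ∀ p : List (I × O), (∀ k, ¬ φ.AdverselyStabilizable S k p) →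
    ∀ (k : ℕ) (S' : Mealy (I × O) (O × Bool)), φ.IsShield S' → φ.SubgameOptimal S' →
      SamePast S S' p → φ.CollaborativelyStabilizes S' k p → φ.CollaborativelyStabilizes S k p

/-! ### The reactive system that implements an admissible strategy -/

theorem W_safe [Nonempty I] {q : Q} (hq : q ∈ φ.W) : q ∈ φ.safe := by
  obtain ⟨f, hf⟩ := hq
  exact (hf fun _ => Classical.arbitrary I).2 0

theorem W_step {q : Q} (hq : q ∈ φ.W) (i : I) : ∃ o : O, φ.step q (i, o) ∈ φ.W := by
  obtain ⟨f, hf⟩ := hq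
  refine ⟨f [] i, fun l => f (i :: l), fun w => ⟨fun _ => Set.mem_univ _, fun n => ?_⟩⟩
  let w' : ℕ → I := fun n => Nat.casesOn n i w
  have key : ∀ n, φ.specGame.play (fun l => f (i :: l)) (φ.step q (i, f [] i)) w n =
      φ.specGame.play f q w' (n + 1) := by
    intro n
    induction n with
    | zero => rfl
    | succ n ih =>
      have hp : prefixOf w' (n + 1) = i :: prefixOf w n := by
        simp [prefixOf, List.range_succ_eq_map, w', Function.comp_def]
      rw [Game.play, ih, Game.play.eq_2 (n := n + 1), hp]
  rw [key]
  exact (hf w').2 (n + 1)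

/-- If the specification is realizable, then the safety game is won from its initial state. -/
theorem productInit_mem_Ws [Nonempty I] (h : φ.init ∈ φ.W) : φ.productInit ∈ φ.Ws := by
  classical
  choose c hc using fun (q : φ.W) (i : I) => φ.W_step q.2 i
  let ρ : ProductState Q → I × O → O × Bool := fun g x =>
    if g.1.2 = 0 ∧ φ.step g.2.2 x ∈ φ.W then (x.2, false)
    else if hq : g.2.2 ∈ φ.W then (c ⟨g.2.2, hq⟩ x.1, false) else (x.2, false)
  let Inv : ProductState Q → Prop := fun g =>
    g.2.2 ∈ φ.W ∧ ((g.1.2 = 0 ∧ g.1.1 = {g.2.2} ∧ g.2.1 = false) ∨ g.1.2 = 2)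
  have hstep : ∀ g x, Inv g → Inv (φ.safetyGame.next g x (ρ g x)) := by
    rintro ⟨⟨u, d⟩, t, q⟩ ⟨i, o⟩ ⟨hq, hd⟩
    simp only at hq hd
    rcases hd with ⟨rfl, rfl, rfl⟩ | rfl
    · by_cases hv : φ.step q (i, o) ∈ φ.W
      · have h1 : ¬ φ.Violates {q} (i, o) := by simp [Violates, hv]
        refine ⟨by simp [safetyGame, ρ, hv], Or.inl ?_⟩
        simp only [safetyGame, monitorStep, h1, ρ, hv, deviationStep, dec]
        refine ⟨by simp, ?_, by simp⟩
        ext q'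
        simp only [if_false, Set.mem_ofPred_eq, Set.mem_singleton_iff, exists_eq_left, true_and,
          if_true]
        exact ⟨fun h => h.2.symm, fun h => ⟨h ▸ hv, h.symm⟩⟩
      · have h1 : φ.Violates {q} (i, o) := by simp [Violates, hv]
        refine ⟨?_, Or.inr ?_⟩
        · simpa [safetyGame, ρ, hv, hq] using hc ⟨q, hq⟩ i
        · simp [safetyGame, monitorStep, h1]
    · refine ⟨?_, Or.inr ?_⟩
      · simpa [safetyGame, ρ, hq] using hc ⟨q, hq⟩ i
      · by_cases h1 : φ.Violates u (i, o)
        · simp [safetyGame, monitorStep, h1]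
        · simp [safetyGame, monitorStep, h1, ρ, hq, dec]
  let step : ProductState Q → I × O → ProductState Q := fun g x => φ.safetyGame.next g x (ρ g x)
  refine ⟨fun l x => ρ (l.foldl step φ.productInit) x, fun w => ⟨fun _ => Set.mem_univ _, ?_⟩⟩
  have hplay : ∀ n, φ.safetyGame.play (fun l x => ρ (l.foldl step φ.productInit) x)
      φ.productInit w n = (prefixOf w n).foldl step φ.productInit := by
    intro n
    induction n with
    | zero => rfl
    | succ n ih =>
      rw [Game.play, ih]
      simp [prefixOf, List.range_succ, step]
  intro n
  have hinv : Inv ((prefixOf w n).foldl step φ.productInit) := by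
    induction n with
    | zero => exact ⟨h, Or.inl ⟨rfl, rfl, rfl⟩⟩
    | succ n ih =>
      have := hstep _ (w n) ih
      simpa [prefixOf, List.range_succ, step] using this
  rw [hplay]
  refine ⟨φ.W_safe hinv.1, fun h0 => ?_⟩
  rcases hinv.2 with h2 | h2
  · exact h2.2.2
  · rw [h0] at h2
    exact absurd h2 (by decide)

/-- The reactive system that implements the strategy `ρ` in the Büchi game: its states are those of
the game, its output function is `ρ`, and it moves along the transitions of the game. -/
def implement [Finite Q] [Nonempty I] (h : φ.init ∈ φ.W)
    (ρ : φ.Ws → I × O → O × Bool) : Mealy (I × O) (O × Bool) where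
  State := φ.Ws
  finite_state := inferInstance
  init := ⟨φ.productInit, φ.productInit_mem_Ws h⟩
  next := fun g x => φ.buchiGame.next g x (ρ g x)
  out := ρ

end SafetySpec

end Shielding

end

namespace Shielding

/-! Shields are the finite-memory ways of staying in `Ws`. Every finite word of letters is produced
by some design (`Mealy.scripted`), so a shield keeps the product safe after every word and acts as a
winning strategy from each state it reaches. Hence every shield traces out plays of the Büchi game,
and stabilization becomes a statement about attractors.

Adverse stabilization: if a shield adversely `k`-stabilizes a trace, the state reached lies in the
`k`-th attractor of the winning accepting states (`AdverselyStabilizes.run_mem_attractor`).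
Conversely, from such a state every shield following `buchiStrategy` stabilizes within `k` steps,
since each answer of least attractor number lowers the index outside the target
(`Game.buchiStrategy_run`). A competitor may change its answer to the last letter of the trace, so
what is compared is the attractor number of successors, which is what the winning strategy
minimizes.

Collaborative stabilization: a subgame optimal competitor never leaves the pruned game. At any
position where `buchiStrategy` prescribes something, the machine `switch` copies the competitor,
plays a prescribed answer and then follows the winning strategy; optimality forces the competitor's
own answer to be as good (`SubgameOptimal.out_mem_prune`). In the cooperative game every reachable
state with `d ≤ 1` is winning, because a non-violating letter always exists. The attractor number
there is thus a lower bound on the recovery time of such competitors, and an admissible strategy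
attains it. -/

theorem prefixOf_succ {X : Type} (w : ℕ → X) (n : ℕ) :
    prefixOf w (n + 1) = prefixOf w n ++ [w n] := by
  simp [prefixOf, List.range_succ]

theorem prefixOf_succ' {X : Type} (w : ℕ → X) (n : ℕ) :
    prefixOf w (n + 1) = w 0 :: prefixOf (fun m => w (m + 1)) n := by
  simp [prefixOf, List.range_succ_eq_map, Function.comp_def]

/-- The infinite word with first letter `x` and remaining letters `w`. -/
def consWord {X : Type} (x : X) (w : ℕ → X) : ℕ → X
  | 0 => x
  | n + 1 => w n

theorem prefixOf_consWord {X : Type} (x : X) (w : ℕ → X) (n : ℕ) :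
    prefixOf (consWord x w) (n + 1) = x :: prefixOf w n :=
  prefixOf_succ' _ _

theorem exists_min_value {α : Type} (f : α → ℕ∞) (s : Set α) (hs : s.Nonempty) :
    ∃ a ∈ s, ∀ b ∈ s, f a ≤ f b :=
  ⟨Function.argminOn f s hs, Function.argminOn_mem f s hs,
    fun _ hb => Function.argminOn_le f s hb⟩

/-! ### Büchi games: attractors, winning regions and positional strategies -/

namespace Game

variable {V X Y : Type}

theorem play_succ' (G : Game V X Y) (f : List X → X → Y) (g : V) (w : ℕ → X) (n : ℕ) :
    G.play f g w (n + 1) = G.play (fun l => f (w 0 :: l)) (G.next g (w 0) (f [] (w 0)))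
      (fun m => w (m + 1)) n := by
  induction n with
  | zero => rfl
  | succ n ih => rw [play, ih, prefixOf_succ', play.eq_2 (n := n)]

/-- `f` wins the Büchi game from `g`. -/
def WinsBuchi (G : Game V X Y) (F : Set V) (f : List X → X → Y) (g : V) : Prop :=
  ∀ w : ℕ → X, (∀ n, f (prefixOf w n) (w n) ∈ G.legal (G.play f g w n) (w n)) ∧
    buchi F (G.play f g w)

theorem WinsBuchi.step {G : Game V X Y} {F : Set V} {f : List X → X → Y} {g : V}
    (h : G.WinsBuchi F f g) (x : X) :
    G.WinsBuchi F (fun l => f (x :: l)) (G.next g x (f [] x)) := by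
  intro w
  have hp : ∀ n, G.play (fun l => f (x :: l)) (G.next g x (f [] x)) w n =
      G.play f g (consWord x w) (n + 1) := fun n => (play_succ' G f g (consWord x w) n).symm
  obtain ⟨h1, h2⟩ := h (consWord x w)
  refine ⟨fun n => ?_, fun n => ?_⟩
  · have := h1 (n + 1)
    rw [prefixOf_consWord] at this
    rw [hp]
    exact this
  · obtain ⟨m, hm, hmF⟩ := h2 (n + 1)
    obtain ⟨m, rfl⟩ : ∃ k, m = k + 1 := ⟨m - 1, by omega⟩
    exact ⟨m, by omega, by rw [hp]; exact hmF⟩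

theorem WinsBuchi.play_mem {G : Game V X Y} {F : Set V} {f : List X → X → Y} {g : V}
    (h : G.WinsBuchi F f g) (w : ℕ → X) (n : ℕ) : G.play f g w n ∈ G.buchiRegion F := by
  induction n generalizing f g w with
  | zero => exact ⟨f, h⟩
  | succ n ih =>
    rw [play_succ']
    exact ih (h.step (w 0)) _

theorem exists_next_mem_buchiRegion {G : Game V X Y} {F : Set V} {g : V}
    (hg : g ∈ G.buchiRegion F) (x : X) : ∃ y ∈ G.legal g x, G.next g x y ∈ G.buchiRegion F := by
  obtain ⟨f, hf⟩ := hg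
  exact ⟨f [] x, (hf fun _ => x).1 0, _, WinsBuchi.step hf x⟩

theorem attractor_mono (G : Game V X Y) (T : Set V) : Monotone (G.attractor T) :=
  monotone_nat_of_le_succ fun _ => Set.subset_union_left

theorem attractorNumber_le_iff (G : Game V X Y) (T : Set V) (g : V) (n : ℕ) :
    G.attractorNumber T g ≤ n ↔ g ∈ G.attractor T n := by
  constructor
  · intro h
    by_contra hn
    have : ((n + 1 : ℕ) : ℕ∞) ≤ G.attractorNumber T g := by
      refine le_iInf₂ fun m hm => ?_
      rw [Nat.cast_le]
      by_contra hlt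
      exact hn (G.attractor_mono T (by omega) hm)
    have h2 := this.trans h
    rw [Nat.cast_le] at h2
    omega
  · exact fun h => iInf₂_le n h

/-- The accepting states that are winning. -/
abbrev target (G : Game V X Y) (F : Set V) : Set V := F ∩ G.buchiRegion F

theorem buchiNumber_le_iff (G : Game V X Y) (F : Set V) (g : V) (n : ℕ) :
    G.buchiNumber F g ≤ n ↔ g ∈ G.attractor (G.target F) n :=
  attractorNumber_le_iff _ _ _ _

/-- The layers are cumulative, so membership may stem from an earlier layer; monotonicity lifts its
answers to index exactly `n - 1`. -/
theorem attractor_step {G : Game V X Y} {T : Set V} {g : V} {n : ℕ}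
    (h : g ∈ G.attractor T n) (hT : g ∉ T) :
    ∃ m, n = m + 1 ∧ ∀ x, ∃ y ∈ G.legal g x, G.next g x y ∈ G.attractor T m := by
  induction n with
  | zero => exact absurd h hT
  | succ n ih =>
    refine ⟨n, rfl, fun x => ?_⟩
    rcases h with h | h
    · obtain ⟨m, rfl, hm⟩ := ih h
      obtain ⟨y, hy, hy'⟩ := hm x
      exact ⟨y, hy, G.attractor_mono T (Nat.le_succ m) hy'⟩
    · exact h x

/-- A winning state of a Büchi game has a finite attractor number. -/
theorem exists_mem_attractor [Finite X] {G : Game V X Y} {F : Set V} {g : V}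
    (hg : g ∈ G.buchiRegion F) : ∃ n, g ∈ G.attractor (G.target F) n := by
  by_contra hA
  push Not at hA
  -- Outside all attractors the environment has a letter that keeps every legal answer outside.
  -- Otherwise each letter has an answer into some layer, and as there are finitely many letters a
  -- common bound `N` puts the state into layer `N + 1`.
  have key : ∀ h : V, ∃ x, (∀ n, h ∉ G.attractor (G.target F) n) →
      ∀ y ∈ G.legal h x, ∀ n, G.next h x y ∉ G.attractor (G.target F) n := by
    intro h
    by_contra! hc
    have hne : Nonempty X := by
      by_contra hX
      rw [not_nonempty_iff] at hX
      exact hA 1 (Or.inr fun x => hX.elim x)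
    have hh : ∀ n, h ∉ G.attractor (G.target F) n := (hc hne.some).1
    choose y hy n hn using fun x => (hc x).2
    obtain ⟨N, hN⟩ := (Set.finite_range n).bddAbove
    exact hh (N + 1) (Or.inr fun x => ⟨y x, hy x,
      G.attractor_mono _ (hN ⟨x, rfl⟩) (hn x)⟩)
  choose c hc using key
  obtain ⟨f, hf⟩ := hg
  -- The play of `f` against the escaping letters `c`, recorded as the word so far together with the
  -- state reached. It never meets the target, although all its states are winning and some are
  -- accepting.
  let L : ℕ → List X × V := fun n => Nat.rec ([], g)
    (fun _ s => (s.1 ++ [c s.2], G.next s.2 (c s.2) (f s.1 (c s.2)))) n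
  let w : ℕ → X := fun n => c (L n).2
  have hp : ∀ n, prefixOf w n = (L n).1 := by
    intro n
    induction n with
    | zero => rfl
    | succ n ih => rw [prefixOf_succ, ih]
  have hplay : ∀ n, G.play f g w n = (L n).2 := by
    intro n
    induction n with
    | zero => rfl
    | succ n ih => rw [play, ih, hp]
  have hout : ∀ n m, G.play f g w n ∉ G.attractor (G.target F) m := by
    intro n
    induction n with
    | zero => exact hA
    | succ n ih =>
      have hl := (hf w).1 n
      have hw : w n = c (G.play f g w n) := by rw [hplay]
      rw [play]
      rw [hw] at hl ⊢
      exact hc _ ih _ hl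
  obtain ⟨m, -, hm⟩ := (hf w).2 0
  exact hout m 0 ⟨hm, WinsBuchi.play_mem hf w m⟩

theorem buchiNumber_lt_top [Finite X] {G : Game V X Y} {F : Set V} {g : V}
    (hg : g ∈ G.buchiRegion F) : ∃ n : ℕ, G.buchiNumber F g ≤ n := by
  simpa only [buchiNumber_le_iff] using exists_mem_attractor hg

/-- If the attractor index of a sequence decreases in every step outside the target, then the target
is visited within as many steps as the index. -/
theorem exists_visit {G : Game V X Y} {T : Set V} {v : ℕ → V}
    (hstep : ∀ n m, v n ∈ G.attractor T (m + 1) → v n ∉ T → v (n + 1) ∈ G.attractor T m)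
    {n k : ℕ} (h : v n ∈ G.attractor T k) : ∃ j ≤ k, v (n + j) ∈ T := by
  induction k generalizing n with
  | zero => exact ⟨0, le_rfl, h⟩
  | succ k ih =>
    by_cases hT : v n ∈ T
    · exact ⟨0, Nat.zero_le _, hT⟩
    · obtain ⟨j, hj, hv⟩ := ih (hstep n k h hT)
      exact ⟨j + 1, by omega, by rwa [add_right_comm, add_assoc] at hv⟩

/-- The strategy that plays the positional strategy `σ` from the state `g`. -/
def positional (G : Game V X Y) (σ : V → X → Y) (g : V) (l : List X) (x : X) : Y :=
  σ (l.foldl (fun h x => G.next h x (σ h x)) g) x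

theorem play_positional (G : Game V X Y) (σ : V → X → Y) (g : V) (w : ℕ → X) (n : ℕ) :
    G.play (G.positional σ g) g w n =
      (prefixOf w n).foldl (fun h x => G.next h x (σ h x)) g := by
  induction n with
  | zero => rfl
  | succ n ih =>
    rw [play, ih, prefixOf_succ, List.foldl_append]
    rfl

theorem play_positional_succ (G : Game V X Y) (σ : V → X → Y) (g : V) (w : ℕ → X) (n : ℕ) :
    G.play (G.positional σ g) g w (n + 1) =
      G.next (G.play (G.positional σ g) g w n) (w n)
        (σ (G.play (G.positional σ g) g w n) (w n)) := by
  rw [play, positional, play_positional]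

/-- A set of accepting states in which the system can stay is winning. -/
theorem mem_buchiRegion_of_invariant {G : Game V X Y} {F P : Set V} (hPF : P ⊆ F)
    (hP : ∀ g ∈ P, ∀ x, ∃ y ∈ G.legal g x, G.next g x y ∈ P) {g : V} (hg : g ∈ P) :
    g ∈ G.buchiRegion F := by
  classical
  have key : ∀ (h : V) (x : X), ∃ y, h ∈ P → y ∈ G.legal h x ∧ G.next h x y ∈ P := by
    intro h x
    by_cases hh : h ∈ P
    · obtain ⟨y, hy⟩ := hP h hh x
      exact ⟨y, fun _ => hy⟩
    · obtain ⟨y, -⟩ := hP g hg x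
      exact ⟨y, fun h' => absurd h' hh⟩
  choose σ hσ using key
  refine ⟨G.positional σ g, fun w => ?_⟩
  have hm : ∀ n, G.play (G.positional σ g) g w n ∈ P := by
    intro n
    induction n with
    | zero => exact hg
    | succ n ih =>
      rw [play_positional_succ]
      exact (hσ _ _ ih).2
  refine ⟨fun n => ?_, fun n => ⟨n, le_rfl, hPF (hm n)⟩⟩
  have := (hσ _ (w n) (hm n)).1
  rwa [positional, ← play_positional]

/-- The states from which the winning states can be forced are winning. -/
theorem mem_buchiRegion_of_mem_attractor [Finite X] {G : Game V X Y} {F : Set V} {g : V} {n : ℕ}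
    (hg : g ∈ G.attractor (G.target F) n) : g ∈ G.buchiRegion F := by
  classical
  -- The union of the layers can be kept: target states are winning, so they have a winning
  -- successor, which again has a finite index.
  let A : Set V := {h | ∃ n, h ∈ G.attractor (G.target F) n}
  have hA : ∀ h ∈ A, ∀ x, ∃ y ∈ G.legal h x, G.next h x y ∈ A := by
    rintro h ⟨n, hn⟩ x
    by_cases hT : h ∈ G.target F
    · obtain ⟨y, hy, hy'⟩ := exists_next_mem_buchiRegion hT.2 x
      exact ⟨y, hy, exists_mem_attractor hy'⟩
    · obtain ⟨m, -, hm⟩ := attractor_step hn hT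
      obtain ⟨y, hy, hy'⟩ := hm x
      exact ⟨y, hy, m, hy'⟩
  have key : ∀ (h : V) (x : X), ∃ y, h ∈ A → y ∈ G.legal h x ∧ ∀ y' ∈ G.legal h x,
      G.buchiNumber F (G.next h x y) ≤ G.buchiNumber F (G.next h x y') := by
    intro h x
    by_cases hh : h ∈ A
    · obtain ⟨y, hy, -⟩ := hA h hh x
      obtain ⟨z, hz, hz'⟩ := exists_min_value (fun y => G.buchiNumber F (G.next h x y))
        (G.legal h x) ⟨y, hy⟩
      exact ⟨z, fun _ => ⟨hz, hz'⟩⟩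
    -- Outside `A` any answer will do; a legal one at `g` shows that some answer exists.
    · obtain ⟨y, -⟩ := hA g ⟨n, hg⟩ x
      exact ⟨y, fun h' => absurd h' hh⟩
  choose σ hσ using key
  refine ⟨G.positional σ g, fun w => ?_⟩
  set v := G.play (G.positional σ g) g w with hv
  have hvs : ∀ n, v (n + 1) = G.next (v n) (w n) (σ (v n) (w n)) :=
    play_positional_succ G σ g w
  have hnext : ∀ n m, v n ∈ A → (∃ y ∈ G.legal (v n) (w n),
      G.next (v n) (w n) y ∈ G.attractor (G.target F) m) →
      v (n + 1) ∈ G.attractor (G.target F) m := by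
    rintro n m hn ⟨y, hy, hy'⟩
    rw [hvs, ← buchiNumber_le_iff]
    rw [← buchiNumber_le_iff] at hy'
    exact ((hσ _ _ hn).2 y hy).trans hy'
  have hm : ∀ n, v n ∈ A := by
    intro n
    induction n with
    | zero => exact ⟨_, hg⟩
    | succ n ih =>
      obtain ⟨y, hy, m, hy'⟩ := hA _ ih (w n)
      exact ⟨m, hnext n m ih ⟨y, hy, hy'⟩⟩
  refine ⟨fun n => ?_, fun n => ?_⟩
  · have := (hσ _ (w n) (hm n)).1
    rwa [positional, ← play_positional]
  · obtain ⟨k, hk⟩ := hm n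
    obtain ⟨j, -, hj⟩ := exists_visit (v := v) (fun n m hn hT => by
      obtain ⟨m', e, hm'⟩ := attractor_step hn hT
      obtain rfl : m = m' := by omega
      exact hnext n m (hm n) (hm' (w n))) hk
    exact ⟨n + j, Nat.le_add_right _ _, hj.1⟩

/-! ### The winning strategy of the Büchi game and the pruned game -/

theorem exists_mem_buchiStrategy [Finite X] {G : Game V X Y} {F : Set V} {g : V} {x : X} {y : Y}
    (hy : y ∈ G.legal g x) (hW : G.next g x y ∈ G.buchiRegion F) :
    ∃ z, z ∈ G.buchiStrategy F g x := by
  obtain ⟨z, hz, hz'⟩ := exists_min_value (fun y => G.buchiNumber F (G.next g x y))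
    (G.legal g x) ⟨y, hy⟩
  -- The minimizer over all legal answers inherits a finite number from the winning successor, and a
  -- finite number implies winning.
  obtain ⟨n, hn⟩ := buchiNumber_lt_top hW
  have := (hz' y hy).trans hn
  rw [buchiNumber_le_iff] at this
  exact ⟨z, hz, mem_buchiRegion_of_mem_attractor this, hz'⟩

theorem exists_mem_buchiStrategy_of_mem_buchiRegion [Finite X] {G : Game V X Y} {F : Set V} {g : V}
    (hg : g ∈ G.buchiRegion F) (x : X) : ∃ z, z ∈ G.buchiStrategy F g x := by
  obtain ⟨y, hy, hy'⟩ := exists_next_mem_buchiRegion hg x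
  exact exists_mem_buchiStrategy hy hy'

/-- A run that follows the winning strategy visits the target within as many steps as the attractor
index of its first state, and infinitely often. -/
theorem buchiStrategy_run [Finite X] {G : Game V X Y} {F : Set V} {v : ℕ → V} {w : ℕ → X}
    {y : ℕ → Y} (hv : ∀ n, v (n + 1) = G.next (v n) (w n) (y n))
    (hy : ∀ n, (∃ z, z ∈ G.buchiStrategy F (v n) (w n)) → y n ∈ G.buchiStrategy F (v n) (w n))
    {k : ℕ} (h0 : v 0 ∈ G.attractor (G.target F) k) :
    (∃ j ≤ k, v j ∈ F) ∧ ∀ n, ∃ m, n ≤ m ∧ v m ∈ F := by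
  have hW : ∀ n, v n ∈ G.buchiRegion F := by
    intro n
    induction n with
    | zero => exact mem_buchiRegion_of_mem_attractor h0
    | succ n ih =>
      rw [hv]
      exact (hy n (exists_mem_buchiStrategy_of_mem_buchiRegion ih _)).2.1
  have hstep : ∀ n m, v n ∈ G.attractor (G.target F) (m + 1) → v n ∉ G.target F →
      v (n + 1) ∈ G.attractor (G.target F) m := by
    intro n m hn hT
    obtain ⟨m', e, hm'⟩ := attractor_step hn hT
    obtain rfl : m = m' := by omega
    obtain ⟨z, hz, hz'⟩ := hm' (w n)
    rw [← buchiNumber_le_iff] at hz' ⊢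
    rw [hv]
    exact ((hy n (exists_mem_buchiStrategy_of_mem_buchiRegion (hW n) _)).2.2 z hz).trans hz'
  refine ⟨?_, fun n => ?_⟩
  · obtain ⟨j, hj, hT⟩ := exists_visit hstep h0
    exact ⟨j, hj, by simpa using hT.1⟩
  · obtain ⟨k, hk⟩ := exists_mem_attractor (hW n)
    obtain ⟨j, -, hT⟩ := exists_visit hstep hk
    exact ⟨n + j, Nat.le_add_right _ _, hT.1⟩

theorem prune_legal_subset (G : Game V X Y) (F : Set V) (g : V) (x : X) :
    (G.prune (G.buchiStrategy F)).legal g x ⊆ G.legal g x := by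
  rintro y (hy | hy)
  · exact hy.1
  · exact hy.2

theorem prune_legal_nonempty {G : Game V X Y} (F : Set V) {g : V} {x : X}
    (h : (G.legal g x).Nonempty) : ((G.prune (G.buchiStrategy F)).legal g x).Nonempty := by
  by_cases hB : ∃ y, y ∈ G.buchiStrategy F g x
  · obtain ⟨y, hy⟩ := hB
    exact ⟨y, Or.inl hy⟩
  · obtain ⟨y, hy⟩ := h
    exact ⟨y, Or.inr ⟨not_exists.1 hB, hy⟩⟩

theorem mem_buchiStrategy_of_mem_prune {G : Game V X Y} {F : Set V} {g : V} {x : X} {y : Y}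
    (hy : y ∈ (G.prune (G.buchiStrategy F)).legal g x) (h : ∃ z, z ∈ G.buchiStrategy F g x) :
    y ∈ G.buchiStrategy F g x := by
  rcases hy with hy | hy
  · exact hy
  · obtain ⟨z, hz⟩ := h
    exact absurd hz (hy.1 z)

theorem exists_isAdmissibleStrategy {G : Game V X Y} (F : Set V)
    (h : ∀ g x, (G.legal g x).Nonempty) : ∃ ρ, G.IsAdmissibleStrategy F ρ := by
  have key : ∀ g x, ∃ y, y ∈ (G.prune (G.buchiStrategy F)).legal g x ∧
      ∀ z ∈ (G.prune (G.buchiStrategy F)).legal g x,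
        (G.prune (G.buchiStrategy F)).cooperative.buchiNumber F (G.next g x y) ≤
          (G.prune (G.buchiStrategy F)).cooperative.buchiNumber F (G.next g x z) :=
    fun g x => exists_min_value
      (fun y => (G.prune (G.buchiStrategy F)).cooperative.buchiNumber F (G.next g x y)) _
      (prune_legal_nonempty F (h g x))
  choose ρ hρ using key
  exact ⟨ρ, hρ⟩

end Game

/-! ### Traces of Mealy machines and scripted designs -/

namespace Mealy

variable {A B : Type}

theorem stateAfter_append_singleton (M : Mealy A B) (l : List A) (a : A) :
    M.stateAfter (l ++ [a]) = M.next (M.stateAfter l) a := by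
  simp [stateAfter]

theorem traceFrom_append (M : Mealy A B) (s : M.State) (l l' : List A) :
    M.traceFrom s (l ++ l') = M.traceFrom s l ++ M.traceFrom (l.foldl M.next s) l' := by
  induction l generalizing s with
  | nil => rfl
  | cons a l ih => simp [traceFrom, ih]

theorem trace_append_singleton (M : Mealy A B) (l : List A) (a : A) :
    M.trace (l ++ [a]) = M.trace l ++ [(a, M.out (M.stateAfter l) a)] :=
  M.traceFrom_append _ _ _

/-- The design that outputs the second components of a given finite word. -/
noncomputable def scripted {I O : Type} [Finite I] [Finite O] [Nonempty O] (l : List (I × O)) : Mealy I O where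
  State := {l' : List (I × O) // l'.length ≤ l.length}
  finite_state := List.finite_length_le _ _
  init := ⟨l, le_rfl⟩
  next := fun s _ => ⟨s.1.tail, by have := s.2; simp; omega⟩
  out := fun s _ => (s.1.head?.map Prod.snd).getD (Classical.arbitrary O)

theorem scripted_trace {I O : Type} [Finite I] [Finite O] [Nonempty O] (l : List (I × O)) :
    (scripted l).trace (l.map Prod.fst) = l := by
  have key : ∀ (l' : List (I × O)) (h : l'.length ≤ l.length),
      (scripted l).traceFrom ⟨l', h⟩ (l'.map Prod.fst) = l' := by
    intro l'
    induction l' with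
    | nil => exact fun _ => rfl
    | cons a l' ih =>
      intro h
      have h' : l'.length ≤ l.length := by simp at h; omega
      exact congrArg₂ List.cons rfl (ih h')
  exact key l le_rfl

end Mealy

/-! ### Shields as strategies in the safety game on the product -/

namespace SafetySpec

variable {Q I O : Type} (φ : SafetySpec Q I O)

/-- The state of the product after a finite trace of a shield. -/
noncomputable def productAfter (τ : List ((I × O) × (O × Bool))) : ProductState Q :=
  τ.foldl (fun g e => φ.safetyGame.next g e.1 e.2) φ.productInit

theorem productAfter_append_singleton (τ : List ((I × O) × (O × Bool)))
    (e : (I × O) × (O × Bool)) :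
    φ.productAfter (τ ++ [e]) = φ.safetyGame.next (φ.productAfter τ) e.1 e.2 := by
  simp [productAfter]

theorem productAfter_fst (τ : List ((I × O) × (O × Bool))) :
    (φ.productAfter τ).1 = τ.foldl (fun v e => φ.monitorStep v e.1 e.2.2) φ.monitorInit := by
  induction τ using List.reverseRecOn with
  | nil => rfl
  | append_singleton τ e ih =>
    rw [productAfter_append_singleton, List.foldl_append, ← ih]
    rfl

theorem counter_eq (τ : List ((I × O) × (O × Bool))) : φ.counter τ = (φ.productAfter τ).1.2 := by
  rw [productAfter_fst]
  rfl

theorem foldl_comp_trace (D : Mealy I O) (S : Mealy (I × O) (O × Bool)) (l : List I) :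
    ((comp D S).trace l).foldl φ.step φ.init = (φ.productAfter (S.trace (D.trace l))).2.2 := by
  have key : ∀ (l : List I) (d : D.State) (s : S.State) (g : ProductState Q),
      ((comp D S).traceFrom (d, s) l).foldl φ.step g.2.2 =
        ((S.traceFrom s (D.traceFrom d l)).foldl
          (fun g e => φ.safetyGame.next g e.1 e.2) g).2.2 := by
    intro l
    induction l with
    | nil => exact fun _ _ _ => rfl
    | cons i l ih =>
      intro d s g
      exact ih _ _ (φ.safetyGame.next g (i, D.out d i) (S.out s (i, D.out d i)))
  exact key l D.init S.init φ.productInit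

theorem isShield_of_mem_productSafe {S : Mealy (I × O) (O × Bool)}
    (h : ∀ l, φ.productAfter (S.trace l) ∈ φ.productSafe) : φ.IsShield S where
  correct D l := by
    rw [foldl_comp_trace]
    exact (h _).1
  minimum_deviation l x h0 := by
    have := (h (l ++ [x])).2 (by rwa [← counter_eq])
    rw [Mealy.trace_append_singleton, productAfter_append_singleton] at this
    symm
    simpa [safetyGame, deviationStep] using this

variable {φ}

/-- The quantifier over designs in `correct` becomes one over words, because the scripted design
outputs exactly `l`. -/
theorem IsShield.mem_productSafe [Finite I] [Finite O] [Nonempty O]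
    {S : Mealy (I × O) (O × Bool)} (hS : φ.IsShield S) (l : List (I × O)) :
    φ.productAfter (S.trace l) ∈ φ.productSafe := by
  constructor
  · have := hS.correct (Mealy.scripted l) (l.map Prod.fst)
    rwa [foldl_comp_trace, Mealy.scripted_trace] at this
  · intro h0
    induction l using List.reverseRecOn with
    | nil => rfl
    | append_singleton l x _ =>
      have := hS.minimum_deviation l x (by rwa [counter_eq])
      rw [Mealy.trace_append_singleton, productAfter_append_singleton]
      simp [safetyGame, deviationStep, this]

/-- The shield itself, continued after `l`, is a winning strategy of the safety game. -/
theorem IsShield.mem_Ws [Finite I] [Finite O] [Nonempty O]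
    {S : Mealy (I × O) (O × Bool)} (hS : φ.IsShield S) (l : List (I × O)) :
    φ.productAfter (S.trace l) ∈ φ.Ws := by
  refine ⟨fun m x => S.out (S.stateAfter (l ++ m)) x, fun w => ⟨fun _ => Set.mem_univ _, ?_⟩⟩
  have hplay : ∀ n, φ.safetyGame.play (fun m x => S.out (S.stateAfter (l ++ m)) x)
      (φ.productAfter (S.trace l)) w n = φ.productAfter (S.trace (l ++ prefixOf w n)) := by
    intro n
    induction n with
    | zero => simp [prefixOf, Game.play]
    | succ n ih =>
      rw [Game.play, ih, prefixOf_succ, ← List.append_assoc, Mealy.trace_append_singleton,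
        productAfter_append_singleton]
  intro n
  rw [hplay]
  exact hS.mem_productSafe _

theorem Ws_subset_productSafe [Nonempty I] [Nonempty O] {g : ProductState Q} (hg : g ∈ φ.Ws) :
    g ∈ φ.productSafe := by
  obtain ⟨f, hf⟩ := hg
  exact (hf fun _ => Classical.arbitrary (I × O)).2 0

theorem buchiGame_legal_nonempty (g : φ.Ws) (x : I × O) :
    (φ.buchiGame.legal g x).Nonempty := by
  obtain ⟨g, f, hf⟩ := g
  refine ⟨f [] x, fun l => f (x :: l), fun w => ⟨fun _ => Set.mem_univ _, fun n => ?_⟩⟩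
  have := (hf (consWord x w)).2 (n + 1)
  rwa [Game.play_succ'] at this

theorem buchiGame_next_coe {g : φ.Ws} {x : I × O} {y : O × Bool}
    (hy : y ∈ φ.buchiGame.legal g x) :
    (φ.buchiGame.next g x y).1 = φ.safetyGame.next g.1 x y := by
  have hy' : φ.safetyGame.next g.1 x y ∈ φ.Ws := hy
  simp [buchiGame, hy']

/-- A machine whose states track the states of the Büchi game and which uses only its transitions
is in the corresponding state of the product. -/
theorem coe_tracking_eq [Nonempty I] (h : φ.init ∈ φ.W) {S : Mealy (I × O) (O × Bool)}
    (π : S.State → φ.Ws) (hinit : π S.init = ⟨φ.productInit, φ.productInit_mem_Ws h⟩)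
    (hnext : ∀ s x, π (S.next s x) = φ.buchiGame.next (π s) x (S.out s x))
    {l : List (I × O)}
    (hlegal : ∀ l' x, (l' ++ [x]) <+: l →
      S.out (S.stateAfter l') x ∈ φ.buchiGame.legal (π (S.stateAfter l')) x) :
    (π (S.stateAfter l)).1 = φ.productAfter (S.trace l) := by
  induction l using List.reverseRecOn with
  | nil => exact congrArg Subtype.val hinit
  | append_singleton l x ih =>
    rw [Mealy.stateAfter_append_singleton, hnext, Mealy.trace_append_singleton,
      productAfter_append_singleton, ← ih fun l' x' hp => hlegal l' x' (hp.trans ⟨_, rfl⟩)]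
    exact buchiGame_next_coe (hlegal l x (List.prefix_refl _))

theorem isShield_of_tracking [Nonempty I] [Nonempty O] (h : φ.init ∈ φ.W)
    {S : Mealy (I × O) (O × Bool)}
    (π : S.State → φ.Ws) (hinit : π S.init = ⟨φ.productInit, φ.productInit_mem_Ws h⟩)
    (hnext : ∀ s x, π (S.next s x) = φ.buchiGame.next (π s) x (S.out s x))
    (hlegal : ∀ l x, S.out (S.stateAfter l) x ∈ φ.buchiGame.legal (π (S.stateAfter l)) x) :
    φ.IsShield S :=
  φ.isShield_of_mem_productSafe fun l => by
    rw [← coe_tracking_eq h π hinit hnext fun l' x _ => hlegal l' x]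
    exact Ws_subset_productSafe (π (S.stateAfter l)).2

/-! ### The run of a shield in the Büchi game -/

section Run

variable [Finite I] [Finite O] [Nonempty O] {S : Mealy (I × O) (O × Bool)}

/-- The state of the Büchi game that a shield reaches on a finite word. -/
noncomputable def IsShield.run (hS : φ.IsShield S) (l : List (I × O)) : φ.Ws :=
  ⟨φ.productAfter (S.trace l), hS.mem_Ws l⟩

theorem IsShield.out_legal (hS : φ.IsShield S) (l : List (I × O)) (x : I × O) :
    S.out (S.stateAfter l) x ∈ φ.buchiGame.legal (hS.run l) x := by
  have := hS.mem_Ws (l ++ [x])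
  rwa [Mealy.trace_append_singleton, productAfter_append_singleton] at this

theorem IsShield.run_append_singleton (hS : φ.IsShield S) (l : List (I × O)) (x : I × O) :
    hS.run (l ++ [x]) = φ.buchiGame.next (hS.run l) x (S.out (S.stateAfter l) x) := by
  apply Subtype.ext
  rw [buchiGame_next_coe (hS.out_legal l x)]
  simp only [run, Mealy.trace_append_singleton, productAfter_append_singleton]

theorem IsShield.recovered_iff (hS : φ.IsShield S) (l : List (I × O)) :
    φ.Recovered S l ↔ hS.run l ∈ φ.buchiAccept := by
  rw [Recovered, counter_eq]
  rfl

theorem IsShield.run_mem_buchiRegion (hS : φ.IsShield S) {p : List (I × O)}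
    (h : ∀ w n, ∃ m, n ≤ m ∧ φ.Recovered S (p ++ prefixOf w m)) :
    hS.run p ∈ φ.buchiGame.buchiRegion φ.buchiAccept := by
  refine ⟨fun l x => S.out (S.stateAfter (p ++ l)) x, fun w => ?_⟩
  have hplay : ∀ n, φ.buchiGame.play (fun l x => S.out (S.stateAfter (p ++ l)) x)
      (hS.run p) w n = hS.run (p ++ prefixOf w n) := by
    intro n
    induction n with
    | zero => simp [prefixOf, Game.play]
    | succ n ih =>
      rw [Game.play, ih, prefixOf_succ, ← List.append_assoc, run_append_singleton]
  refine ⟨fun n => ?_, fun n => ?_⟩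
  · rw [hplay]
    exact hS.out_legal _ _
  · obtain ⟨m, hm, hr⟩ := h w n
    exact ⟨m, hm, by rw [hplay]; exact (hS.recovered_iff _).1 hr⟩

/-- Before recovery no step count `j` can be `0`, so after one more letter the trace is stabilized
with `k` lowered by one. Recurrence of recovery makes the accepting state that is reached a winning
one. -/
theorem AdverselyStabilizes.run_mem_attractor [Nonempty I] (hS : φ.IsShield S) {k : ℕ}
    {p : List (I × O)} (h : φ.AdverselyStabilizes S k p) :
    hS.run p ∈ φ.buchiGame.attractor (φ.buchiGame.target φ.buchiAccept) k := by
  induction k generalizing p with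
  | zero =>
    obtain ⟨j, hj, hr⟩ := (h fun _ => Classical.arbitrary _).1
    obtain rfl : j = 0 := by omega
    refine ⟨(hS.recovered_iff p).1 ?_, hS.run_mem_buchiRegion fun w => (h w).2⟩
    simpa [prefixOf] using hr
  | succ k ih =>
    by_cases h0 : φ.Recovered S p
    · exact Game.attractor_mono _ _ (Nat.zero_le _)
        ⟨(hS.recovered_iff p).1 h0, hS.run_mem_buchiRegion fun w => (h w).2⟩
    · refine Or.inr fun x => ⟨_, hS.out_legal p x, ?_⟩
      rw [← hS.run_append_singleton]
      refine ih fun w => ?_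
      obtain ⟨⟨j, hj, hr⟩, hinf⟩ := h (consWord x w)
      constructor
      · cases j with
        | zero => exact absurd (by simpa [prefixOf] using hr) h0
        | succ j =>
          rw [prefixOf_consWord] at hr
          exact ⟨j, by omega, by simpa using hr⟩
      · intro n
        obtain ⟨m, hm, hr⟩ := hinf (n + 1)
        cases m with
        | zero => omega
        | succ m =>
          rw [prefixOf_consWord] at hr
          exact ⟨m, by omega, by simpa using hr⟩

/-- A shield that follows the winning strategy after the trace `p`. -/
theorem adverselyStabilizes_of_follows (hS : φ.IsShield S) {k : ℕ} {p : List (I × O)}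
    (hf : ∀ l x, (∃ z, z ∈ φ.buchiGame.buchiStrategy φ.buchiAccept (hS.run (p ++ l)) x) →
      S.out (S.stateAfter (p ++ l)) x ∈
        φ.buchiGame.buchiStrategy φ.buchiAccept (hS.run (p ++ l)) x)
    (hp : hS.run p ∈ φ.buchiGame.attractor (φ.buchiGame.target φ.buchiAccept) k) :
    φ.AdverselyStabilizes S k p := by
  intro w
  simp only [hS.recovered_iff]
  refine Game.buchiStrategy_run (v := fun n => hS.run (p ++ prefixOf w n)) (w := w)
    (y := fun n => S.out (S.stateAfter (p ++ prefixOf w n)) (w n)) (fun n => ?_)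
    (fun n => hf _ _) (by simpa [prefixOf] using hp)
  rw [prefixOf_succ, ← List.append_assoc, hS.run_append_singleton]

end Run

/-! ### Switching to a positional strategy -/

/-- The machine that uses the strategy `f` for `N` steps and the positional strategy `σ` of the
Büchi game afterwards. -/
noncomputable def switch [Finite Q] [Finite I] [Finite O] [Nonempty I] (h : φ.init ∈ φ.W)
    (f : List (I × O) → I × O → O × Bool) (σ : φ.Ws → I × O → O × Bool) (N : ℕ) :
    Mealy (I × O) (O × Bool) where
  -- The recorded history stops growing at length `N`, which keeps the machine finite; from then on
  -- only the game state matters.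
  State := {l : List (I × O) // l.length ≤ N} × φ.Ws
  finite_state := by
    have : Finite {l : List (I × O) // l.length ≤ N} := List.finite_length_le _ _
    infer_instance
  init := (⟨[], Nat.zero_le _⟩, ⟨φ.productInit, φ.productInit_mem_Ws h⟩)
  next := fun s x =>
    (if hl : s.1.1.length < N then ⟨s.1.1 ++ [x], by simpa using hl⟩ else s.1,
      φ.buchiGame.next s.2 x (if s.1.1.length < N then f s.1.1 x else σ s.2 x))
  out := fun s x => if s.1.1.length < N then f s.1.1 x else σ s.2 x

section Switch

variable [Finite Q] [Finite I] [Finite O] [Nonempty I] (h : φ.init ∈ φ.W)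
    (f : List (I × O) → I × O → O × Bool) (σ : φ.Ws → I × O → O × Bool) (N : ℕ)

theorem switch_stateAfter_fst (l : List (I × O)) :
    ((switch h f σ N).stateAfter l).1.1 = l.take N := by
  induction l using List.reverseRecOn with
  | nil => simp [Mealy.stateAfter, switch]
  | append_singleton l x ih =>
    rw [Mealy.stateAfter_append_singleton]
    have e : ∀ s, ((switch h f σ N).next s x).1.1 =
        if s.1.1.length < N then s.1.1 ++ [x] else s.1.1 := by
      intro s
      by_cases hs : s.1.1.length < N <;> simp [switch, hs]
    rw [e, ih, List.length_take]
    split_ifs with hl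
    · have : l.length < N := by omega
      rw [List.take_of_length_le this.le, List.take_of_length_le (by simpa using this)]
    · rw [List.take_append_of_le_length (by omega)]

theorem switch_out_of_lt {l : List (I × O)} (hl : l.length < N) (x : I × O) :
    (switch h f σ N).out ((switch h f σ N).stateAfter l) x = f l x := by
  have e := switch_stateAfter_fst h f σ N l
  rw [List.take_of_length_le hl.le] at e
  change (if ((switch h f σ N).stateAfter l).1.1.length < N then _ else _) = _
  rw [e, if_pos hl]

theorem switch_out_of_le {l : List (I × O)} (hl : N ≤ l.length) (x : I × O) :
    (switch h f σ N).out ((switch h f σ N).stateAfter l) x =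
      σ ((switch h f σ N).stateAfter l).2 x := by
  have e := switch_stateAfter_fst h f σ N l
  change (if ((switch h f σ N).stateAfter l).1.1.length < N then _ else _) = _
  rw [e, if_neg (by simp [hl])]

end Switch

/-- Supplies the tail of `switch`: it follows the winning strategy where that prescribes something
and remains in `Ws` everywhere, so the machine is a shield on all words. -/
theorem exists_strategy_mem_prune :
    ∃ σ : φ.Ws → I × O → O × Bool, ∀ g x,
      σ g x ∈ (φ.buchiGame.prune (φ.buchiGame.buchiStrategy φ.buchiAccept)).legal g x := by
  choose σ hσ using fun g x =>
    Game.prune_legal_nonempty φ.buchiAccept (buchiGame_legal_nonempty (φ := φ) g x)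
  exact ⟨σ, hσ⟩

/-- A shield could answer the last letter by moving to a winning state and be adversely stabilizing
from there on. -/
theorem IsShield.adverselyStabilizable [Finite Q] [Finite I] [Finite O] [Nonempty I] [Nonempty O]
    (h : φ.init ∈ φ.W) {S : Mealy (I × O) (O × Bool)} (hS : φ.IsShield S) {p : List (I × O)}
    {x : I × O} {y : O × Bool} {k : ℕ} (hy : y ∈ φ.buchiGame.legal (hS.run p) x)
    (hk : φ.buchiGame.next (hS.run p) x y ∈
      φ.buchiGame.attractor (φ.buchiGame.target φ.buchiAccept) k) :
    φ.AdverselyStabilizable S k (p ++ [x]) := by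
  classical
  obtain ⟨σ, hσ⟩ := exists_strategy_mem_prune (φ := φ)
  -- Copies `S` except for the one answer to `x` after `p`. With `p.length + 1` scripted steps this
  -- is the last one before `σ` takes over, so traces up to the length of `p` agree with those of
  -- `S`.
  let f : List (I × O) → I × O → O × Bool := fun l x' =>
    if l = p ∧ x' = x then y else S.out (S.stateAfter l) x'
  let M := switch h f σ (p.length + 1)
  let π : M.State → φ.Ws := Prod.snd
  have hlt : ∀ l x', l.length ≤ p.length → M.out (M.stateAfter l) x' = f l x' :=
    fun l x' hl => switch_out_of_lt _ _ _ _ (by omega) _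
  have hge : ∀ l x', p.length < l.length →
      M.out (M.stateAfter l) x' = σ (π (M.stateAfter l)) x' :=
    fun l x' hl => switch_out_of_le _ _ _ _ hl _
  have htrace : ∀ l, l.length ≤ p.length → M.trace l = S.trace l := by
    intro l
    induction l using List.reverseRecOn with
    | nil => exact fun _ => rfl
    | append_singleton l x' ih =>
      intro hl
      rw [List.length_append, List.length_singleton] at hl
      have hne : ¬ (l = p ∧ x' = x) := by
        rintro ⟨rfl, -⟩
        omega
      rw [Mealy.trace_append_singleton, Mealy.trace_append_singleton, ih (by omega),
        hlt _ _ (by omega)]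
      simp only [f, if_neg hne]
  have hnext : ∀ s x, π (M.next s x) = φ.buchiGame.next (π s) x (M.out s x) := fun _ _ => rfl
  have hlegal : ∀ l x', M.out (M.stateAfter l) x' ∈ φ.buchiGame.legal (π (M.stateAfter l)) x' := by
    intro l
    -- Legality after `l` needs the tracked state to be the true product state, which in turn needs
    -- legality on all shorter words.
    induction hn : l.length using Nat.strong_induction_on generalizing l with
    | _ n ih =>
    subst hn
    intro x'
    by_cases hl : l.length < p.length + 1
    · have e : π (M.stateAfter l) = hS.run l := by
        apply Subtype.ext
        rw [coe_tracking_eq h π rfl hnext, htrace l (by omega)]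
        · rfl
        · intro l' x'' hp
          have := hp.length_le
          rw [List.length_append, List.length_singleton] at this
          exact ih _ (by omega) l' rfl x''
      rw [e, hlt _ _ (by omega)]
      by_cases hc : l = p ∧ x' = x
      · simp only [f, if_pos hc]
        rw [hc.1, hc.2]
        exact hy
      · simp only [f, if_neg hc]
        exact hS.out_legal l x'
    · rw [hge _ _ (by omega)]
      exact Game.prune_legal_subset _ _ _ _ (hσ _ _)
  have hMS : φ.IsShield M := isShield_of_tracking h π rfl hnext hlegal
  have hrun : ∀ l, π (M.stateAfter l) = hMS.run l := fun l =>
    Subtype.ext (coe_tracking_eq h π rfl hnext fun l' x' _ => hlegal l' x')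
  refine ⟨M, hMS, ?_, ?_⟩
  · rw [SamePast, List.dropLast_concat, htrace p le_rfl]
  · refine adverselyStabilizes_of_follows hMS (fun l x' hz => ?_) ?_
    · rw [hge _ _ (by simp), hrun]
      exact Game.mem_buchiStrategy_of_mem_prune (hσ _ _) hz
    · have e : hMS.run p = hS.run p := Subtype.ext (congrArg φ.productAfter (htrace p le_rfl))
      rw [hMS.run_append_singleton, e, hlt _ _ le_rfl]
      simpa only [f, and_self, if_true] using hk

theorem SamePast.run_eq [Finite I] [Finite O] [Nonempty O] {S S' : Mealy (I × O) (O × Bool)}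
    (hS : φ.IsShield S) (hS' : φ.IsShield S') {p : List (I × O)} {x : I × O}
    (h : SamePast S S' (p ++ [x])) : hS'.run p = hS.run p := by
  rw [SamePast, List.dropLast_concat] at h
  exact Subtype.ext (congrArg φ.productAfter h)

/-- A subgame optimal shield follows the winning strategy of the Büchi game. -/
theorem SubgameOptimal.out_mem_prune [Finite Q] [Finite I] [Finite O] [Nonempty I] [Nonempty O]
    (h : φ.init ∈ φ.W) {S : Mealy (I × O) (O × Bool)} (hS : φ.IsShield S)
    (hopt : φ.SubgameOptimal S) (p : List (I × O)) (x : I × O) :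
    S.out (S.stateAfter p) x ∈
      (φ.buchiGame.prune (φ.buchiGame.buchiStrategy φ.buchiAccept)).legal (hS.run p) x := by
  by_cases hB : ∃ z, z ∈ φ.buchiGame.buchiStrategy φ.buchiAccept (hS.run p) x
  · obtain ⟨z, hz⟩ := hB
    -- A shield answering `z` would stabilize within the attractor number of its successor; by
    -- optimality so does `S`, which bounds the number of the successor chosen by `S`.
    have key : ∀ k : ℕ, φ.buchiGame.buchiNumber φ.buchiAccept
        (φ.buchiGame.next (hS.run p) x z) ≤ k →
        φ.buchiGame.next (hS.run p) x (S.out (S.stateAfter p) x) ∈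
          φ.buchiGame.attractor (φ.buchiGame.target φ.buchiAccept) k := by
      intro k hk
      rw [Game.buchiNumber_le_iff] at hk
      rw [← hS.run_append_singleton]
      exact (hopt _ k (hS.adverselyStabilizable h hz.1 hk)).run_mem_attractor hS
    obtain ⟨n, hn⟩ := Game.buchiNumber_lt_top hz.2.1
    refine Or.inl ⟨hS.out_legal p x, Game.mem_buchiRegion_of_mem_attractor (key n hn),
      fun y' hy' => le_trans ?_ (hz.2.2 y' hy')⟩
    obtain ⟨m, hm⟩ := ENat.ne_top_iff_exists.1 (ne_top_of_le_ne_top (ENat.natCast_ne_top n) hn)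
    rw [← hm, Game.buchiNumber_le_iff]
    exact key m hm.ge
  · exact Or.inr ⟨not_exists.1 hB, hS.out_legal p x⟩

/-! ### The cooperative game -/

/-- The monitored states are winning, and there are some. -/
def Monitored (φ : SafetySpec Q I O) (u : Set Q) : Prop := u.Nonempty ∧ u ⊆ φ.W

theorem Monitored.step [Nonempty I] {v : MonitorState Q} (hv : φ.Monitored v.1) (x : I × O)
    (z : Bool) : φ.Monitored (φ.monitorStep v x z).1 := by
  obtain ⟨⟨q, hq⟩, hW⟩ := hv
  unfold monitorStep
  split_ifs with hx
  · obtain ⟨o, ho⟩ := φ.W_step (hW hq) x.1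
    exact ⟨⟨_, ho, q, hq, o, rfl⟩, fun _ h => h.1⟩
  · simp only [Violates, not_forall, not_not] at hx
    obtain ⟨q', hq', h'⟩ := hx
    exact ⟨⟨_, h', q', hq', rfl⟩, fun _ h => h.1⟩

theorem monitored_productAfter [Nonempty I] (h : φ.init ∈ φ.W)
    (τ : List ((I × O) × (O × Bool))) : φ.Monitored (φ.productAfter τ).1.1 := by
  induction τ using List.reverseRecOn with
  | nil => exact ⟨⟨φ.init, rfl⟩, fun _ hq => hq ▸ h⟩
  | append_singleton τ e ih =>
    rw [productAfter_append_singleton]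
    exact ih.step e.1 e.2.2

theorem Monitored.exists_not_violates [Nonempty I] {u : Set Q} (hu : φ.Monitored u) :
    ∃ x : I × O, ¬ φ.Violates u x := by
  obtain ⟨⟨q, hq⟩, hW⟩ := hu
  obtain ⟨o, ho⟩ := φ.W_step (hW hq) (Classical.arbitrary I)
  exact ⟨(_, o), fun hv => hv q hq ho⟩

/-- The cooperative game in which the winning strategy of the Büchi game is respected. -/
noncomputable abbrev coopGame (φ : SafetySpec Q I O) : Game φ.Ws Unit ((I × O) × (O × Bool)) :=
  (φ.buchiGame.prune (φ.buchiGame.buchiStrategy φ.buchiAccept)).cooperative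

/-- The cooperating environment can always pick a non-violating letter, and from `d ≤ 1` such a
letter leads to `d = 0` whatever the shield answers. Reaching recovery thus already means reaching
the target. -/
theorem mem_buchiRegion_coopGame [Nonempty I] {g : φ.Ws} (hg : φ.Monitored g.1.1.1)
    (hF : g ∈ φ.buchiAccept) : g ∈ φ.coopGame.buchiRegion φ.buchiAccept := by
  refine Game.mem_buchiRegion_of_invariant
    (P := {g : φ.Ws | φ.Monitored g.1.1.1 ∧ g ∈ φ.buchiAccept}) (fun _ h => h.2) ?_ ⟨hg, hF⟩
  rintro g ⟨hg, hF⟩ -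
  obtain ⟨x, hx⟩ := hg.exists_not_violates
  obtain ⟨y, hy⟩ := Game.prune_legal_nonempty φ.buchiAccept (buchiGame_legal_nonempty g x)
  have e : (φ.coopGame.next g () (x, y)).1 = φ.safetyGame.next g.1 x y :=
    buchiGame_next_coe (Game.prune_legal_subset _ _ _ _ hy)
  refine ⟨(x, y), hy, ?_, ?_⟩
  · rw [e]
    exact hg.step x y.2
  · have hd : g.1.1.2 ≠ 2 := by
      intro h2
      have hF' : g.1.1.2 ≤ 1 := hF
      rw [h2] at hF'
      exact absurd hF' (by decide)
    change (φ.coopGame.next g () (x, y)).1.1.2 ≤ 1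
    rw [e]
    simp [safetyGame, monitorStep, hx, dec, hd]

theorem IsShield.mem_attractor_coopGame [Finite I] [Finite O] [Nonempty I] [Nonempty O]
    (h : φ.init ∈ φ.W) {S : Mealy (I × O) (O × Bool)} (hS : φ.IsShield S)
    (hf : ∀ l x, S.out (S.stateAfter l) x ∈
      (φ.buchiGame.prune (φ.buchiGame.buchiStrategy φ.buchiAccept)).legal (hS.run l) x)
    {p : List (I × O)} {w : ℕ → I × O} {j : ℕ} (hr : φ.Recovered S (p ++ prefixOf w j)) :
    hS.run p ∈ φ.coopGame.attractor (φ.coopGame.target φ.buchiAccept) j := by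
  induction j generalizing p w with
  | zero =>
    have hF : hS.run p ∈ φ.buchiAccept := (hS.recovered_iff p).1 (by simpa [prefixOf] using hr)
    exact ⟨hF, mem_buchiRegion_coopGame (monitored_productAfter h _) hF⟩
  | succ j ih =>
    refine Or.inr fun _ => ⟨(w 0, S.out (S.stateAfter p) (w 0)), hf p _, ?_⟩
    rw [prefixOf_succ'] at hr
    have := ih (p := p ++ [w 0]) (by simpa using hr)
    rwa [hS.run_append_singleton] at this

/-- The continuation takes the input letters of a shortest path in the cooperative game; the
shield's own answer to each letter has a number no larger than the answer on the path. -/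
theorem collaborativelyStabilizes_of_mem_attractor [Finite I] [Finite O] [Nonempty I] [Nonempty O]
    {S : Mealy (I × O) (O × Bool)} (hS : φ.IsShield S)
    (hf : ∀ l x, ∀ y ∈ (φ.buchiGame.prune (φ.buchiGame.buchiStrategy φ.buchiAccept)).legal
        (hS.run l) x,
      φ.coopGame.buchiNumber φ.buchiAccept
        (φ.buchiGame.next (hS.run l) x (S.out (S.stateAfter l) x)) ≤
      φ.coopGame.buchiNumber φ.buchiAccept (φ.buchiGame.next (hS.run l) x y))
    {p : List (I × O)} {k : ℕ}
    (hk : hS.run p ∈ φ.coopGame.attractor (φ.coopGame.target φ.buchiAccept) k) :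
    φ.CollaborativelyStabilizes S k p := by
  induction k generalizing p with
  | zero =>
    refine ⟨fun _ => Classical.arbitrary _, 0, le_rfl, ?_⟩
    simpa [prefixOf] using (hS.recovered_iff p).2 hk.1
  | succ k ih =>
    rcases hk with hk | hk
    · obtain ⟨w, j, hj, hr⟩ := ih hk
      exact ⟨w, j, by omega, hr⟩
    · obtain ⟨⟨x, y⟩, hy, hy'⟩ := hk ()
      have hlt : hS.run (p ++ [x]) ∈
          φ.coopGame.attractor (φ.coopGame.target φ.buchiAccept) k := by
        rw [← Game.buchiNumber_le_iff] at hy' ⊢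
        rw [hS.run_append_singleton]
        exact (hf p x y hy).trans hy'
      obtain ⟨w, j, hj, hr⟩ := ih hlt
      refine ⟨consWord x w, j + 1, by omega, ?_⟩
      rw [prefixOf_consWord]
      simpa using hr

/-- A shield that plays an admissible strategy of the Büchi game is admissible. -/
theorem IsShield.isAdmissibleShield [Finite Q] [Finite I] [Finite O] [Nonempty I] [Nonempty O]
    (h : φ.init ∈ φ.W) {S : Mealy (I × O) (O × Bool)} (hS : φ.IsShield S)
    {ρ : φ.Ws → I × O → O × Bool}
    (hρ : φ.buchiGame.IsAdmissibleStrategy φ.buchiAccept ρ)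
    (hout : ∀ l x, S.out (S.stateAfter l) x = ρ (hS.run l) x) : φ.IsAdmissibleShield S where
  shield := hS
  adverse := by
    rintro p k ⟨S', hS', hp, hk⟩
    have hB : ∀ l x, (∃ z, z ∈ φ.buchiGame.buchiStrategy φ.buchiAccept (hS.run l) x) →
        S.out (S.stateAfter l) x ∈ φ.buchiGame.buchiStrategy φ.buchiAccept (hS.run l) x := by
      intro l x hz
      rw [hout]
      exact Game.mem_buchiStrategy_of_mem_prune (hρ _ _).1 hz
    refine adverselyStabilizes_of_follows hS (fun l => hB _) ?_
    have hk' := hk.run_mem_attractor hS'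
    induction p using List.reverseRecOn with
    | nil => exact hk'
    | append_singleton p x _ =>
      -- Both shields are in the same state before the last letter, so the competitor's answer is
      -- among those over which `S` minimizes.
      rw [hS'.run_append_singleton] at hk'
      have hl := hS'.out_legal p x
      rw [hp.run_eq hS hS'] at hk' hl
      have hz := hB p x (Game.exists_mem_buchiStrategy hl
        (Game.mem_buchiRegion_of_mem_attractor hk'))
      rw [hS.run_append_singleton]
      rw [← Game.buchiNumber_le_iff] at hk' ⊢
      exact (hz.2.2 _ hl).trans hk'
  collaborative := by
    rintro p - k S' hS' hopt hp ⟨w, j, hj, hr⟩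
    induction p using List.reverseRecOn with
    | nil =>
      -- The monitor starts with `d = 0`, so the empty trace is already recovered.
      refine ⟨w, 0, Nat.zero_le _, ?_⟩
      change (0 : Fin 3) ≤ 1
      decide
    | append_singleton p x _ =>
      have hprune := hopt.out_mem_prune h hS'
      have hk := Game.attractor_mono _ _ hj (hS'.mem_attractor_coopGame h hprune hr)
      refine collaborativelyStabilizes_of_mem_attractor hS (fun l x y hy => ?_) ?_
      · rw [hout]
        exact (hρ _ _).2 y hy
      · have hl := hprune p x
        rw [hS'.run_append_singleton] at hk
        rw [hp.run_eq hS hS'] at hk hl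
        rw [hS.run_append_singleton]
        rw [← Game.buchiNumber_le_iff] at hk ⊢
        rw [hout]
        exact ((hρ _ _).2 _ hl).trans hk

end SafetySpec

end Shielding

/-! ### Existence and admissibility -/

theorem mainTheorem7 {Q I O : Type} [Finite Q] [Finite I] [Finite O] [Nonempty I] [Nonempty O]
    (φ : Shielding.SafetySpec Q I O) (hφ : φ.init ∈ φ.W) :
    (∃ ρ : φ.Ws → I × O → O × Bool, φ.buchiGame.IsAdmissibleStrategy φ.buchiAccept ρ) ∧
    ∀ ρ : φ.Ws → I × O → O × Bool, φ.buchiGame.IsAdmissibleStrategy φ.buchiAccept ρ →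
      φ.IsAdmissibleShield (φ.implement hφ ρ) := by
  refine ⟨Shielding.Game.exists_isAdmissibleStrategy _
    Shielding.SafetySpec.buchiGame_legal_nonempty, fun ρ hρ => ?_⟩
  have hlegal : ∀ g x, ρ g x ∈ φ.buchiGame.legal g x := fun g x =>
    Shielding.Game.prune_legal_subset _ _ _ _ (hρ g x).1
  have hS : φ.IsShield (φ.implement hφ ρ) :=
    Shielding.SafetySpec.isShield_of_tracking hφ id rfl (fun _ _ => rfl) fun _ _ => hlegal _ _
  refine hS.isAdmissibleShield hφ hρ fun l x => congrArg (fun g => ρ g x) (Subtype.ext ?_)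
  exact Shielding.SafetySpec.coe_tracking_eq hφ (S := φ.implement hφ ρ) id rfl (fun _ _ => rfl)
    fun _ _ _ => hlegal _ _
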